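/- Let $f$ be a polynomial with complex coefficients of degree $d\ge 2$ which is monic and centered, i.e. $f(z)=z^d+c_{d-2}z^{d-2}+\dots+c_0$, and let $f^n$ ($n\ge 1$) denote its $n$-th iterate. Let $\varphi^{-1}(z)=az+b$ with $a\in\mathbb{C}\setminus\{0\}$ and $b\in\mathbb{C}$. For a polynomial $p$ of degree at least $2$ let $K_p$ be its filled Julia set (the set of points with bounded forward orbit under $p$) and $J_p=\partial K_p$ its Julia set. For a sequence $(S_n)_{n\ge1}$ of subsets of $\mathbb{C}$ let $\liminf_n S_n$ be the set of limits of convergent sequences $(z_n)_{n\ge1}$ with $z_n\in S_n$ for all $n$, and let $\limsup_n S_n$ be the set of limits of convergent sequences $(z_{n_k})_k$ with $z_{n_k}\in S_{n_k}$ for some strictly increasing sequence $(n_k)_k$ of indices. Then $$J_f\subseteq\liminf_{n\to\infty}J_{\varphi^{-1}\circ f^n}\subseteq\limsup_{n\to\infty}K_{\varphi^{-1}\circ f^n}\subseteq K_f .$$ In particular, if $J_f=K_f$, then $\lim_{n\to\infty}J_{\varphi^{-1}\circ f^n}=J_f$, that is, $\liminf_{n}J_{\varphi^{-1}\circ f^n}=\limsup_{n}J_{\varphi^{-1}\circ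 f^n}=J_f$, and the sets $J_{\varphi^{-1}\circ f^n}$ ($n\ge1$) converge to $J_f$ in the Hausdorff distance on the space of non-empty compact subsets of $\mathbb{C}$. -/

import Mathlib

open Polynomial Filter Topology

/-- The filled Julia set of a complex polynomial (of degree at least two): the set of points
whose forward orbit is bounded. -/
def filledJuliaSet (p : ℂ[X]) : Set ℂ :=
  {z | Bornology.IsBounded (Set.range fun n : ℕ => (fun w : ℂ => p.eval w)^[n] z)}

/-- The Julia set of a complex polynomial (of degree at least two): the boundary of its filled
Julia set, equivalently of its basin of attraction of infinity. -/
def juliaSet (p : ℂ[X]) : Set ℂ :=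
  frontier (filledJuliaSet p)

/-- The lower limit of a sequence `S 1, S 2, S 3, …` of subsets of the plane (the value `S 0` is
ignored): all limits of convergent sequences `z 1, z 2, …` with `z n ∈ S n`. -/
def setLiminf (S : ℕ → Set ℂ) : Set ℂ :=
  {x | ∃ z : ℕ → ℂ, (∀ n, 1 ≤ n → z n ∈ S n) ∧ Tendsto z atTop (𝓝 x)}

/-- The upper limit of a sequence `S 1, S 2, S 3, …` of subsets of the plane (the value `S 0` is
ignored): all limits of sequences of points of `S` along a strictly increasing sequence of
indices. -/
def setLimsup (S : ℕ → Set ℂ) : Set ℂ :=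
  {x | ∃ n : ℕ → ℕ, StrictMono n ∧ (∀ k, 1 ≤ n k) ∧
    ∃ z : ℕ → ℂ, (∀ k, z k ∈ S (n k)) ∧ Tendsto z atTop (𝓝 x)}

/-- Convergence of `S 1, S 2, S 3, …` to `L` in the space of non-empty compact subsets of the
plane, equipped with the Hausdorff distance. -/
def TendstoHausdorff (S : ℕ → Set ℂ) (L : Set ℂ) : Prop :=
  (∀ n, 1 ≤ n → (S n).Nonempty ∧ IsCompact (S n)) ∧ L.Nonempty ∧ IsCompact L ∧
    Tendsto (fun n => Metric.hausdorffEDist (S n) L) atTop (𝓝 0)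

/-- The polynomial `a * f^n(z) + b`, where `f^n` is the `n`-th iterate of `f` under composition. -/
noncomputable def affineIterate (a b : ℂ) (f : ℂ[X]) (n : ℕ) : ℂ[X] :=
  (C a * X + C b).comp (f.comp^[n] X)

/-! Write `P_n = a * f^n + b`. Upper inclusion: the `P_n` share an escape radius for large `n`, and
off `K_f` the iterates tend to infinity locally uniformly, so `P_n` eventually carries a whole
neighbourhood beyond that radius.

Lower inclusion: let `x ∈ J_f` and take an escaping point `y` near `x`. If `J_{P_n}` missed a ball
about `x`, connectedness would make the ball miss `K_{P_n}`, and complete invariance would make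
`f^n` omit `(w - b) / a` there for every `w ∈ K_{P_n}`. As `f` is monic, `K_{P_n}` lies in no disk
of radius `1/8`, so two omitted values stay bounded and uniformly apart. Since they move with `n`, a
quantitative Schottky estimate, `norm_mul_le_of_omits`, is used: `f^n` is bounded at `x`, which
forces `|f^n y| = O(d^n)`, whereas `|f^n y|` grows at least like `(2d)^n`. -/

/-! ### Holomorphic logarithms and a Schottky-type estimate -/

/-- A nowhere vanishing holomorphic function on a disk has a holomorphic logarithm with any
prescribed admissible value at the centre. -/
theorem exists_differentiableOn_log_ball {f : ℂ → ℂ} {c : ℂ} {r : ℝ} (hr : 0 < r)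
    (hf : DifferentiableOn ℂ f (Metric.ball c r)) (h0 : ∀ z ∈ Metric.ball c r, f z ≠ 0)
    {w : ℂ} (hw : Complex.exp w = f c) :
    ∃ L : ℂ → ℂ, DifferentiableOn ℂ L (Metric.ball c r) ∧ L c = w ∧
      ∀ z ∈ Metric.ball c r, Complex.exp (L z) = f z := by
  have hc : c ∈ Metric.ball c r := Metric.mem_ball_self hr
  -- `G` is a primitive of `f' / f`, so `f * exp (-G)` has zero derivative.
  obtain ⟨G, hG⟩ := ((hf.deriv Metric.isOpen_ball).div hf h0).isExactOn_ball
  have hconst : ∀ z ∈ Metric.ball c r,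
      f z * Complex.exp (-G z) = f c * Complex.exp (-G c) := by
    have hder : ∀ z ∈ Metric.ball c r,
        HasDerivAt (fun z => f z * Complex.exp (-G z)) 0 z := by
      intro z hz
      have h1 := (hf.differentiableAt (Metric.isOpen_ball.mem_nhds hz)).hasDerivAt
      convert! h1.mul (hG z hz).neg.cexp using 1
      have := h0 z hz
      simp only [Pi.div_apply]
      field_simp
      ring
    intro z hz
    exact (convex_ball c r).is_const_of_fderivWithin_eq_zero (𝕜 := ℂ)
      (fun x hx => (hder x hx).differentiableAt.differentiableWithinAt)
      (fun x hx => by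
        rw [fderivWithin_of_isOpen Metric.isOpen_ball hx]
        have := (hder x hx).hasFDerivAt.fderiv
        simp_all) hz hc
  refine ⟨fun z => G z - G c + w, ?_, by simp, fun z hz => ?_⟩
  · intro z hz
    exact (((hG z hz).differentiableAt.sub_const _).add_const _).differentiableWithinAt
  · have h := hconst z hz
    calc Complex.exp (G z - G c + w) = f c * Complex.exp (-G c) * Complex.exp (G z) := by
          rw [Complex.exp_add, hw, sub_eq_add_neg, Complex.exp_add]
          ring
      _ = f z := by rw [← h, mul_assoc, ← Complex.exp_add]; simp

/-- Borel–Carathéodory, recentred. It is applied to logarithms, whose real part is bounded above by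
a bound on the modulus of the function. -/
theorem norm_sub_le_of_re_sub_le {f : ℂ → ℂ} {c : ℂ} {r M : ℝ} (hr : 0 < r) (hM : 0 < M)
    (hf : DifferentiableOn ℂ f (Metric.ball c r))
    (hre : ∀ z ∈ Metric.ball c r, (f z).re - (f c).re ≤ M) {z : ℂ} (hz : z ∈ Metric.ball c r) :
    ‖f z - f c‖ ≤ 2 * M * ‖z - c‖ / (r - ‖z - c‖) := by
  have hmem : ∀ x ∈ Metric.ball (0 : ℂ) r, c + x ∈ Metric.ball c r := by
    intro x hx
    simpa using hx
  have h := Complex.borelCaratheodory_zero (f := fun x => f (c + x) - f c) (R := r) (M := M)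
    (z := z - c) hM
    ((hf.comp (by fun_prop) hmem).sub_const _)
    (fun x hx => by simpa using hre _ (hmem x hx)) hr
    (by simpa [dist_eq_norm] using hz) (by simp)
  simpa using h

/-- A quantitative form of the theorem of Schottky, for functions whose growth is controlled: a
holomorphic function on a disk which omits two values and is large at the centre is large near
the centre. -/
theorem norm_mul_le_of_omits {F : ℂ → ℂ} {c u v : ℂ} {r A : ℝ} (hr : 0 < r) (hA : 0 < A)
    (hF : DifferentiableOn ℂ F (Metric.ball c r))
    (hu : ∀ z ∈ Metric.ball c r, F z ≠ u) (hv : ∀ z ∈ Metric.ball c r, F z ≠ v)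
    (huA : ∀ z ∈ Metric.ball c r, ‖F z - u‖ ≤ Real.exp A)
    (hvA : ∀ z ∈ Metric.ball c r, ‖F z - v‖ ≤ Real.exp A)
    (hcu : 1 ≤ ‖F c - u‖) (hcv : 1 ≤ ‖F c - v‖) (huv : u ≠ v)
    (hq : 2 * (4 * A + 1) * ‖u - v‖ ≤ ‖F c - v‖) {z : ℂ} (hz : ‖z - c‖ ≤ r / 10) :
    ‖u - v‖ * ‖F c - v‖ ≤ 6 * (4 * A + 1) * ‖F z - v‖ ^ 2 := by
  have hc : c ∈ Metric.ball c r := Metric.mem_ball_self hr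
  have hsub : Metric.ball c (r / 2) ⊆ Metric.ball c r := Metric.ball_subset_ball (by linarith)
  have hFu : F c - u ≠ 0 := sub_ne_zero.2 (hu c hc)
  have hFv : F c - v ≠ 0 := sub_ne_zero.2 (hv c hc)
  have huv0 : 0 < ‖u - v‖ := norm_pos_iff.2 (sub_ne_zero.2 huv)
  have hFv0 : 0 < ‖F c - v‖ := by linarith
  -- The ratio `(F c - u) / (F c - v)` is close to 1, so its principal logarithm is small; the
  -- branch of `Lu` is chosen below to make `Lu c - Lv c` equal to it.
  set l := Complex.log (1 + (v - u) / (F c - v)) with hl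
  have hratio : 1 + (v - u) / (F c - v) = (F c - u) / (F c - v) := by
    field_simp
    ring
  have hsmall : (4 * A + 1) * (‖u - v‖ / ‖F c - v‖) ≤ 1 / 2 := by
    rw [← mul_div_assoc, div_le_iff₀ hFv0]
    linarith
  have hpos : 0 < ‖u - v‖ / ‖F c - v‖ := by positivity
  have hlb : ‖l‖ ≤ 3 / 2 * (‖u - v‖ / ‖F c - v‖) := by
    have := Complex.norm_log_one_add_half_le_self (z := (v - u) / (F c - v))
      (by rw [norm_div, norm_sub_rev v u]; nlinarith)
    rwa [norm_div, norm_sub_rev v u] at this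
  have hexpl : Complex.exp l = (F c - u) / (F c - v) := by
    rw [hl, hratio, Complex.exp_log (div_ne_zero hFu hFv)]
  obtain ⟨Lv, hLvd, hLvc, hLv⟩ := exists_differentiableOn_log_ball hr (hF.sub_const v)
    (fun z hz => sub_ne_zero.2 (hv z hz)) (Complex.exp_log hFv)
  obtain ⟨Lu, hLud, hLuc, hLu⟩ := exists_differentiableOn_log_ball hr (hF.sub_const u)
    (fun z hz => sub_ne_zero.2 (hu z hz)) (w := l + Complex.log (F c - v))
    (by rw [Complex.exp_add, hexpl, Complex.exp_log hFv]; field_simp)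
  -- Both logarithms vary by at most `2 * A` on the half disk.
  have hvar : ∀ (L : ℂ → ℂ) (t : ℂ), DifferentiableOn ℂ L (Metric.ball c r) →
      (∀ z ∈ Metric.ball c r, Complex.exp (L z) = F z - t) →
      (∀ z ∈ Metric.ball c r, ‖F z - t‖ ≤ Real.exp A) → 1 ≤ ‖F c - t‖ →
      ∀ z ∈ Metric.ball c (r / 2), ‖L z - L c‖ ≤ 2 * A := by
    intro L t hLd hL htA hct z hz
    have hc0 : 0 ≤ (L c).re := by
      rw [← hL c hc, Complex.norm_exp] at hct
      exact Real.one_le_exp_iff.1 hct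
    have h := norm_sub_le_of_re_sub_le hr hA hLd (fun x hx => by
      have := htA x hx
      rw [← hL x hx, Complex.norm_exp, Real.exp_le_exp] at this
      linarith) (hsub hz)
    rw [Metric.mem_ball, dist_eq_norm] at hz
    refine h.trans ?_
    rw [div_le_iff₀ (by linarith)]
    nlinarith
  have hmem2 : z ∈ Metric.ball c (r / 2) := by
    rw [Metric.mem_ball, dist_eq_norm]
    linarith
  have hexpL : ∀ z ∈ Metric.ball c r,
      Complex.exp (Lu z - Lv z) = (F z - u) / (F z - v) := fun z hz => by
    rw [Complex.exp_sub, hLu z hz, hLv z hz]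
  have hLne : ∀ z ∈ Metric.ball c r, Lu z - Lv z ≠ 0 := by
    intro z hz h
    have h1 := hexpL z hz
    rw [h, Complex.exp_zero, eq_comm, div_eq_one_iff_eq (sub_ne_zero.2 (hv z hz))] at h1
    exact huv (sub_right_injective h1)
  have hLc : Lu c - Lv c = l := by rw [hLuc, hLvc]; ring
  have hl0 : l ≠ 0 := hLc ▸ hLne c hc
  have hlpos : 0 < ‖l‖ := norm_pos_iff.2 hl0
  have hl1 : ‖l‖ < 1 := by nlinarith
  have hLbound : ∀ z ∈ Metric.ball c (r / 2), ‖Lu z - Lv z‖ ≤ 4 * A + 1 := by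
    intro z hz
    have h1 := hvar Lu u hLud hLu huA hcu z hz
    have h2 := hvar Lv v hLvd hLv hvA hcv z hz
    calc ‖Lu z - Lv z‖ = ‖(Lu z - Lu c) - (Lv z - Lv c) + l‖ := by rw [← hLc]; ring_nf
      _ ≤ ‖Lu z - Lu c‖ + ‖Lv z - Lv c‖ + ‖l‖ :=
        (norm_add_le _ _).trans (by gcongr; exact norm_sub_le _ _)
      _ ≤ 4 * A + 1 := by linarith
  -- `Lu - Lv` has no zeros because `u ≠ v`, so it has a logarithm in turn.
  obtain ⟨G, hGd, hGc, hG⟩ := exists_differentiableOn_log_ball (half_pos hr)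
    ((hLud.sub hLvd).mono hsub) (fun z hz => hLne z (hsub hz)) (w := Complex.log l)
    (by rw [Complex.exp_log hl0]; exact hLc.symm)
  have hB : 0 < 4 * A + 1 := by linarith
  have hGcre : (G c).re = Real.log ‖l‖ := by rw [hGc, Complex.log_re]
  have hM : 0 < Real.log (4 * A + 1) - Real.log ‖l‖ :=
    sub_pos.2 (Real.log_lt_log hlpos (by linarith))
  have hGz := norm_sub_le_of_re_sub_le (half_pos hr) hM hGd (fun x hx => by
    have h1 := hLbound x hx
    have h2 : ‖Complex.exp (G x)‖ = ‖Lu x - Lv x‖ := congrArg norm (hG x hx)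
    rw [← h2, Complex.norm_exp, ← Real.le_log_iff_exp_le hB] at h1
    rw [hGcre]
    linarith) hmem2
  -- With `|z - c| ≤ r / 10` on the disk of radius `r / 2`, the factor is at most `2 * (1/10) / (1/2
  -- - 1/10) = 1/2`. Hence `|Lu z - Lv z|` is at most the geometric mean of `4 * A + 1` and `|l|`.
  have hGz2 : ‖G z - G c‖ ≤ (Real.log (4 * A + 1) - Real.log ‖l‖) / 2 := by
    refine hGz.trans ?_
    rw [div_le_iff₀ (by linarith)]
    nlinarith
  have hre : (G z).re ≤ (Real.log (4 * A + 1) + Real.log ‖l‖) / 2 := by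
    have := (Complex.re_le_norm (G z - G c)).trans hGz2
    rw [Complex.sub_re, hGcre] at this
    linarith
  have hsq : ‖Lu z - Lv z‖ ^ 2 ≤ (4 * A + 1) * ‖l‖ := by
    have h2 : ‖Complex.exp (G z)‖ = ‖Lu z - Lv z‖ := congrArg norm (hG z hmem2)
    rw [← h2, Complex.norm_exp, ← Real.exp_nat_mul,
      ← Real.exp_log (mul_pos hB hlpos), Real.exp_le_exp, Real.log_mul hB.ne' hlpos.ne']
    push_cast
    linarith
  have hzr := hsub hmem2
  have hFz : F z - v ≠ 0 := sub_ne_zero.2 (hv z hzr)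
  have hFz0 : 0 < ‖F z - v‖ := norm_pos_iff.2 hFz
  have hone : ‖Lu z - Lv z‖ ≤ 1 := by
    rw [← sq_le_one_iff₀ (norm_nonneg _)]
    nlinarith
  have hexp := Complex.norm_exp_sub_one_le hone
  have hid : (F z - u) / (F z - v) - 1 = (v - u) / (F z - v) := by
    field_simp
    ring
  rw [hexpL z hzr, hid, norm_div, norm_sub_rev v u] at hexp
  have hfin : (‖u - v‖ / ‖F z - v‖) ^ 2 ≤ 6 * (4 * A + 1) * (‖u - v‖ / ‖F c - v‖) := by
    calc (‖u - v‖ / ‖F z - v‖) ^ 2 ≤ (2 * ‖Lu z - Lv z‖) ^ 2 := by gcongr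
      _ = 4 * ‖Lu z - Lv z‖ ^ 2 := by ring
      _ ≤ 4 * ((4 * A + 1) * (3 / 2 * (‖u - v‖ / ‖F c - v‖))) := by
        gcongr
        exact hsq.trans (by gcongr)
      _ = _ := by ring
  rw [div_pow, ← mul_div_assoc, div_le_div_iff₀ (by positivity) hFv0] at hfin
  refine le_of_mul_le_mul_left ?_ huv0
  linarith

/-! ### Escape, growth and size of filled Julia sets -/

section FilledJuliaSet

theorem exists_mul_norm_le_norm_eval {p : ℂ[X]} (hp : 2 ≤ p.natDegree) (K : ℝ) :
    ∃ R : ℝ, 1 ≤ R ∧ ∀ z : ℂ, R ≤ ‖z‖ → K * ‖z‖ ≤ ‖p.eval z‖ := by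
  have hdeg : 0 < p.divX.degree := by
    rw [← natDegree_pos_iff_degree_pos, natDegree_divX_eq_natDegree_tsub_one]
    omega
  have h := p.divX.tendsto_norm_atTop hdeg (z := id)
    (tendsto_comap : Tendsto (fun z : ℂ => ‖z‖) (comap norm atTop) atTop)
  obtain ⟨R, hR⟩ := eventually_atTop.1 <| eventually_comap.1 <|
    h.eventually_ge_atTop (K + ‖p.coeff 0‖)
  refine ⟨max 1 R, le_max_left _ _, fun z hz => ?_⟩
  have h1 : K + ‖p.coeff 0‖ ≤ ‖p.divX.eval z‖ := hR ‖z‖ (le_trans (le_max_right _ _) hz) z rfl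
  have h2 : (1 : ℝ) ≤ ‖z‖ := le_trans (le_max_left _ _) hz
  have h3 : p.eval z = p.divX.eval z * z + p.coeff 0 := by
    conv_lhs => rw [← divX_mul_X_add p]
    simp
  have h4 := norm_sub_le_norm_add (p.divX.eval z * z) (p.coeff 0)
  rw [norm_mul] at h4
  rw [h3]
  nlinarith [norm_nonneg (p.coeff 0)]

theorem mem_filledJuliaSet_iff {p : ℂ[X]} {z : ℂ} :
    z ∈ filledJuliaSet p ↔
      Bornology.IsBounded (Set.range fun n : ℕ => (fun w : ℂ => p.eval w)^[n] z) :=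
  Iff.rfl

theorem pow_mul_norm_le_norm_iterate {p : ℂ[X]} {K R : ℝ} (hK : 1 ≤ K)
    (h : ∀ z : ℂ, R ≤ ‖z‖ → K * ‖z‖ ≤ ‖p.eval z‖) (n : ℕ) {z : ℂ} (hz : R ≤ ‖z‖) :
    K ^ n * ‖z‖ ≤ ‖(fun w : ℂ => p.eval w)^[n] z‖ := by
  induction n with
  | zero => simp
  | succ n ih =>
    have h1 : ‖z‖ ≤ K ^ n * ‖z‖ := le_mul_of_one_le_left (norm_nonneg _) (one_le_pow₀ hK)
    rw [Function.iterate_succ_apply', pow_succ', mul_assoc]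
    exact le_trans (by gcongr) (h _ (hz.trans (h1.trans ih)))

/-- The two orbits differ by one point. This invariance turns missing the filled Julia set into
omitting values. -/
theorem eval_mem_filledJuliaSet_iff {p : ℂ[X]} {z : ℂ} :
    p.eval z ∈ filledJuliaSet p ↔ z ∈ filledJuliaSet p := by
  constructor
  · intro h
    refine ((mem_filledJuliaSet_iff.1 h).insert z).subset ?_
    rintro _ ⟨n, rfl⟩
    cases n with
    | zero => simp
    | succ n => exact Or.inr ⟨n, rfl⟩
  · intro h
    refine Bornology.IsBounded.subset (mem_filledJuliaSet_iff.1 h) ?_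
    rintro _ ⟨n, rfl⟩
    exact ⟨n + 1, rfl⟩

theorem iterate_eval_mem_filledJuliaSet {p : ℂ[X]} {z : ℂ} (hz : z ∈ filledJuliaSet p) (n : ℕ) :
    (fun w : ℂ => p.eval w)^[n] z ∈ filledJuliaSet p := by
  induction n with
  | zero => exact hz
  | succ n ih =>
    rw [Function.iterate_succ_apply']
    exact eval_mem_filledJuliaSet_iff.2 ih

theorem norm_lt_of_mem_filledJuliaSet {p : ℂ[X]} {R : ℝ} (hR : 1 ≤ R)
    (h : ∀ z : ℂ, R ≤ ‖z‖ → 2 * ‖z‖ ≤ ‖p.eval z‖) {z : ℂ} (hz : z ∈ filledJuliaSet p) :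
    ‖z‖ < R := by
  by_contra! hRz
  obtain ⟨C, hC⟩ := isBounded_iff_forall_norm_le.1 (mem_filledJuliaSet_iff.1 hz)
  obtain ⟨n, hn⟩ := pow_unbounded_of_one_lt C (one_lt_two (α := ℝ))
  have h1 := pow_mul_norm_le_norm_iterate one_le_two h n hRz
  have h2 := hC _ ⟨n, rfl⟩
  have h3 : (2 : ℝ) ^ n ≤ 2 ^ n * ‖z‖ := le_mul_of_one_le_right (by positivity) (hR.trans hRz)
  exact absurd (h3.trans (h1.trans h2)) (not_le.2 hn)

/-- A bound independent of `z` exhibits the set as an intersection of closed sets. -/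
theorem mem_filledJuliaSet_iff_forall_norm_le {p : ℂ[X]} {R : ℝ} (hR : 1 ≤ R)
    (h : ∀ z : ℂ, R ≤ ‖z‖ → 2 * ‖z‖ ≤ ‖p.eval z‖) {z : ℂ} :
    z ∈ filledJuliaSet p ↔ ∀ n : ℕ, ‖(fun w : ℂ => p.eval w)^[n] z‖ ≤ R := by
  constructor
  · exact fun hz n => (norm_lt_of_mem_filledJuliaSet hR h (iterate_eval_mem_filledJuliaSet hz n)).le
  · intro hz
    refine mem_filledJuliaSet_iff.2 (isBounded_iff_forall_norm_le.2 ⟨R, ?_⟩)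
    rintro _ ⟨n, rfl⟩
    exact hz n

theorem continuous_iterate_eval (p : ℂ[X]) (n : ℕ) :
    Continuous (fun w : ℂ => p.eval w)^[n] :=
  p.continuous.iterate n

theorem isCompact_filledJuliaSet {p : ℂ[X]} (hp : 2 ≤ p.natDegree) :
    IsCompact (filledJuliaSet p) := by
  obtain ⟨R, hR, h⟩ := exists_mul_norm_le_norm_eval hp 2
  refine Metric.isCompact_of_isClosed_isBounded ?_ ?_
  · have : filledJuliaSet p = ⋂ n : ℕ, {z | ‖(fun w : ℂ => p.eval w)^[n] z‖ ≤ R} := by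
      ext z
      simp [mem_filledJuliaSet_iff_forall_norm_le hR h]
    rw [this]
    exact isClosed_iInter fun n => isClosed_le (continuous_iterate_eval p n).norm continuous_const
  · exact isBounded_iff_forall_norm_le.2 ⟨R, fun z hz => (norm_lt_of_mem_filledJuliaSet hR h hz).le⟩

theorem filledJuliaSet_nonempty {p : ℂ[X]} (hp : 2 ≤ p.natDegree) :
    (filledJuliaSet p).Nonempty := by
  have hd : (p - X).natDegree = p.natDegree :=
    natDegree_sub_eq_left_of_natDegree_lt (by rw [natDegree_X]; omega)
  obtain ⟨z, hz⟩ := IsAlgClosed.exists_root (p - X)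
    (degree_ne_of_natDegree_ne (n := 0) (by omega))
  have hfix : p.eval z = z := by simpa [IsRoot, sub_eq_zero] using hz
  refine ⟨z, (Bornology.isBounded_singleton (x := z)).subset ?_⟩
  rintro _ ⟨n, rfl⟩
  exact Function.iterate_fixed hfix n

theorem juliaSet_subset_filledJuliaSet {p : ℂ[X]} (hp : 2 ≤ p.natDegree) :
    juliaSet p ⊆ filledJuliaSet p :=
  (isCompact_filledJuliaSet hp).isClosed.frontier_subset

theorem isCompact_juliaSet {p : ℂ[X]} (hp : 2 ≤ p.natDegree) : IsCompact (juliaSet p) :=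
  (isCompact_filledJuliaSet hp).of_isClosed_subset isClosed_frontier
    (juliaSet_subset_filledJuliaSet hp)

theorem juliaSet_nonempty {p : ℂ[X]} (hp : 2 ≤ p.natDegree) : (juliaSet p).Nonempty :=
  nonempty_frontier_iff.2 ⟨filledJuliaSet_nonempty hp, (isCompact_filledJuliaSet hp).ne_univ⟩

/-- The orbit of a point with unbounded orbit grows faster than any geometric sequence, uniformly
near the point. -/
theorem exists_pow_le_norm_iterate {p : ℂ[X]} (hp : 2 ≤ p.natDegree) {K : ℝ} (hK : 2 ≤ K) {x : ℂ}
    (hx : x ∉ filledJuliaSet p) :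
    ∃ m : ℕ, ∀ᶠ z in 𝓝 x, ∀ k : ℕ, K ^ k ≤ ‖(fun w : ℂ => p.eval w)^[m + k] z‖ := by
  obtain ⟨R, hR, h⟩ := exists_mul_norm_le_norm_eval hp K
  have h2 : ∀ z : ℂ, R ≤ ‖z‖ → 2 * ‖z‖ ≤ ‖p.eval z‖ := fun z hz =>
    le_trans (by gcongr) (h z hz)
  rw [mem_filledJuliaSet_iff_forall_norm_le hR h2] at hx
  push Not at hx
  obtain ⟨m, hm⟩ := hx
  refine ⟨m, ?_⟩
  filter_upwards [(continuous_iterate_eval p m).norm.continuousAt.eventually_const_lt hm] with z hz k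
  rw [add_comm, Function.iterate_add_apply]
  refine le_trans ?_ (pow_mul_norm_le_norm_iterate (by linarith) h k hz.le)
  exact le_mul_of_one_le_right (by positivity) (hR.trans hz.le)

/-- The orbits of a bounded set grow at most doubly exponentially. -/
theorem exists_norm_iterate_le_exp {p : ℂ[X]} (hp : 2 ≤ p.natDegree) (ρ : ℝ) :
    ∃ M : ℝ, 0 ≤ M ∧ ∀ (n : ℕ) (z : ℂ), ‖z‖ ≤ ρ →
      ‖(fun w : ℂ => p.eval w)^[n] z‖ ≤ Real.exp (M * p.natDegree ^ n) := by
  set S : ℝ := 1 + ∑ i ∈ Finset.range (p.natDegree + 1), ‖p.coeff i‖ with hS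
  have hsum : 0 ≤ ∑ i ∈ Finset.range (p.natDegree + 1), ‖p.coeff i‖ := by positivity
  have hS1 : 1 ≤ S := by linarith
  have hstep : ∀ w : ℂ, max 1 ‖p.eval w‖ ≤ S * max 1 ‖w‖ ^ p.natDegree := by
    intro w
    have hm : (1 : ℝ) ≤ max 1 ‖w‖ := le_max_left _ _
    refine max_le (one_le_mul_of_one_le_of_one_le hS1 (one_le_pow₀ hm)) ?_
    rw [eval_eq_sum_range]
    calc ‖∑ i ∈ Finset.range (p.natDegree + 1), p.coeff i * w ^ i‖
        ≤ ∑ i ∈ Finset.range (p.natDegree + 1), ‖p.coeff i‖ * max 1 ‖w‖ ^ p.natDegree := by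
          refine norm_sum_le_of_le _ fun i hi => ?_
          rw [norm_mul, norm_pow]
          gcongr
          exact (pow_le_pow_left₀ (norm_nonneg _) (le_max_right _ _) i).trans
            (pow_le_pow_right₀ hm (by simpa [Nat.lt_succ_iff] using hi))
      _ ≤ S * max 1 ‖w‖ ^ p.natDegree := by
          rw [← Finset.sum_mul]
          gcongr
          linarith
  have hbase : 1 ≤ S * max 1 ρ := one_le_mul_of_one_le_of_one_le hS1 (le_max_left _ _)
  refine ⟨Real.log (S * max 1 ρ), Real.log_nonneg hbase, fun n z hz => ?_⟩
  -- The prefactor `S` closes the induction: `S ^ 2 ≤ S ^ d` as `d ≥ 2`.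
  have key : S * max 1 ‖(fun w : ℂ => p.eval w)^[n] z‖ ≤ (S * max 1 ρ) ^ p.natDegree ^ n := by
    induction n with
    | zero =>
      simp only [Function.iterate_zero, id, pow_zero, pow_one]
      gcongr
    | succ n ih =>
      rw [Function.iterate_succ_apply', pow_succ, pow_mul]
      set t := max 1 ‖(fun w : ℂ => p.eval w)^[n] z‖ with ht
      have ht1 : 1 ≤ t := le_max_left _ _
      calc _ ≤ S * (S * t ^ p.natDegree) := by gcongr; exact hstep _
        _ = S ^ 2 * t ^ p.natDegree := by ring
        _ ≤ S ^ p.natDegree * t ^ p.natDegree := by gcongr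
        _ = (S * t) ^ p.natDegree := (mul_pow _ _ _).symm
        _ ≤ _ := by gcongr
  have hexp : Real.exp (Real.log (S * max 1 ρ) * p.natDegree ^ n) =
      (S * max 1 ρ) ^ p.natDegree ^ n := by
    rw [mul_comm, ← Nat.cast_pow, Real.exp_nat_mul, Real.exp_log (by linarith)]
  rw [hexp]
  refine le_trans ?_ key
  refine (le_max_right 1 _).trans (le_mul_of_one_le_left (by positivity) hS1)

theorem norm_multiset_prod_map_sub_le {s : Multiset ℂ} {z : ℂ} {t : ℝ}
    (h : ∀ r ∈ s, ‖z - r‖ ≤ t) : ‖(s.map (z - ·)).prod‖ ≤ t ^ s.card := by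
  induction s using Multiset.induction_on with
  | empty => simp
  | cons r s ih =>
    have hr := h r (Multiset.mem_cons_self r s)
    have hs := ih fun q hq => h q (Multiset.mem_cons_of_mem hq)
    rw [Multiset.map_cons, Multiset.prod_cons, norm_mul, Multiset.card_cons, pow_succ']
    exact mul_le_mul hr hs (norm_nonneg _) ((norm_nonneg _).trans hr)

/-- The filled Julia set of a polynomial whose leading coefficient is not too large is not
contained in a small disk. -/
theorem not_filledJuliaSet_subset_closedBall {p : ℂ[X]} (hp : 2 ≤ p.natDegree)
    (hlead : ‖p.leadingCoeff‖ * (3 / 8) ^ p.natDegree ≤ 1 / 8) (c : ℂ) :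
    ¬ filledJuliaSet p ⊆ Metric.closedBall c (1 / 8) := by
  intro hsub
  obtain ⟨w, hw⟩ := filledJuliaSet_nonempty hp
  have hdeg : (p - C w).natDegree = p.natDegree := natDegree_sub_C
  have hlc : (p - C w).leadingCoeff = p.leadingCoeff :=
    leadingCoeff_sub_of_degree_lt (degree_lt_degree (by rw [natDegree_C]; omega))
  -- All roots of `p - w` lie in the small disk by backward invariance, so each factor `z - r` has
  -- modulus at most `1/4 + 1/8 = 3/8`. The invariant disk of radius `1/4` then lies in the filled
  -- Julia set, a contradiction.
  have hmaps : ∀ z ∈ Metric.closedBall c (1 / 4), p.eval z ∈ Metric.closedBall c (1 / 4) := by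
    intro z hz
    have hprod : ‖p.eval z - w‖ ≤ 1 / 8 := by
      have hev := (IsAlgClosed.splits (p - C w)).eval_eq_prod_roots z
      rw [eval_sub, eval_C] at hev
      rw [hev, norm_mul, hlc]
      refine le_trans ?_ hlead
      gcongr
      rw [← hdeg, ← IsAlgClosed.card_roots_eq_natDegree (p := p - C w)]
      refine norm_multiset_prod_map_sub_le fun r hr => ?_
      have hr' : p.eval r = w := by
        simpa [IsRoot, sub_eq_zero] using (mem_roots'.1 hr).2
      have hrc := hsub (eval_mem_filledJuliaSet_iff.1 (hr' ▸ hw))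
      rw [mem_closedBall_iff_norm] at hz hrc
      calc ‖z - r‖ = ‖(z - c) - (r - c)‖ := by ring_nf
        _ ≤ 1 / 4 + 1 / 8 := (norm_sub_le _ _).trans (add_le_add hz hrc)
        _ = 3 / 8 := by norm_num
    have hwc := hsub hw
    rw [mem_closedBall_iff_norm] at *
    calc ‖p.eval z - c‖ = ‖(p.eval z - w) + (w - c)‖ := by ring_nf
      _ ≤ 1 / 8 + 1 / 8 := norm_add_le_of_le hprod hwc
      _ = 1 / 4 := by norm_num
  have hz : c + 1 / 4 ∈ filledJuliaSet p := by
    refine (Metric.isBounded_closedBall (x := c) (r := 1 / 4)).subset ?_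
    rintro _ ⟨n, rfl⟩
    exact Set.MapsTo.iterate hmaps n (by simp)
  have := hsub hz
  rw [mem_closedBall_iff_norm] at this
  norm_num at this

end FilledJuliaSet

/-! ### The maps `a * f^n + b` -/

section AffineIterate

theorem eval_affineIterate (a b : ℂ) (f : ℂ[X]) (n : ℕ) (z : ℂ) :
    (affineIterate a b f n).eval z = a * (fun w : ℂ => f.eval w)^[n] z + b := by
  simp [affineIterate]

theorem natDegree_affineIterate {a : ℂ} (ha : a ≠ 0) (b : ℂ) (f : ℂ[X]) (n : ℕ) :
    (affineIterate a b f n).natDegree = f.natDegree ^ n := by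
  rw [affineIterate, natDegree_comp, natDegree_linear ha, one_mul, natDegree_iterate_comp,
    natDegree_X, mul_one]

theorem two_le_natDegree_affineIterate {a : ℂ} (ha : a ≠ 0) (b : ℂ) {f : ℂ[X]}
    (hf : 2 ≤ f.natDegree) {n : ℕ} (hn : 1 ≤ n) : 2 ≤ (affineIterate a b f n).natDegree := by
  rw [natDegree_affineIterate ha]
  exact hf.trans (Nat.le_self_pow (by omega) _)

theorem Polynomial.Monic.iterate_comp {f : ℂ[X]} (hf : f.Monic) (hd : f.natDegree ≠ 0) (n : ℕ) :
    (f.comp^[n] X).Monic := by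
  induction n with
  | zero => exact monic_X
  | succ n ih =>
    rw [Function.iterate_succ_apply']
    refine hf.comp ih ?_
    rw [natDegree_iterate_comp, natDegree_X, mul_one]
    exact pow_ne_zero _ hd

theorem leadingCoeff_affineIterate {a : ℂ} (ha : a ≠ 0) (b : ℂ) {f : ℂ[X]} (hf : f.Monic)
    (hd : f.natDegree ≠ 0) (n : ℕ) : (affineIterate a b f n).leadingCoeff = a := by
  rw [affineIterate, leadingCoeff_comp, leadingCoeff_linear ha,
    (hf.iterate_comp hd n).leadingCoeff, one_pow, mul_one]
  rw [natDegree_iterate_comp, natDegree_X, mul_one]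
  exact pow_ne_zero _ hd

theorem eventually_le_pow {t s : ℝ} (hs : 0 < s) : ∀ᶠ n : ℕ in atTop, t ≤ s * 2 ^ n :=
  ((tendsto_pow_atTop_atTop_of_one_lt (one_lt_two (α := ℝ))).const_mul_atTop
    hs).eventually_ge_atTop t

/-- The polynomials `a * f^n + b` have a common escape radius for all large `n`. -/
theorem exists_eventually_mul_norm_le_norm_eval_affineIterate {a : ℂ} (ha : a ≠ 0) (b : ℂ)
    {f : ℂ[X]} (hf : 2 ≤ f.natDegree) :
    ∃ R : ℝ, 1 ≤ R ∧ ∀ᶠ n : ℕ in atTop,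
      ∀ z : ℂ, R ≤ ‖z‖ → 2 * ‖z‖ ≤ ‖(affineIterate a b f n).eval z‖ := by
  obtain ⟨R, hR, h⟩ := exists_mul_norm_le_norm_eval hf 2
  refine ⟨R, hR, ?_⟩
  filter_upwards [eventually_le_pow (t := 2 + ‖b‖) (norm_pos_iff.2 ha)] with n hn z hz
  have h1 := pow_mul_norm_le_norm_iterate one_le_two h n hz
  have h2 : 1 ≤ ‖z‖ := hR.trans hz
  have h3 := norm_sub_le_norm_add (a * (fun w : ℂ => f.eval w)^[n] z) b
  rw [eval_affineIterate]
  rw [norm_mul] at h3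
  have h4 : ‖a‖ * (2 ^ n * ‖z‖) ≤ ‖a‖ * ‖(fun w : ℂ => f.eval w)^[n] z‖ := by gcongr
  nlinarith [norm_nonneg b]

theorem exists_eventually_filledJuliaSet_subset_ball {a : ℂ} (ha : a ≠ 0) (b : ℂ)
    {f : ℂ[X]} (hf : 2 ≤ f.natDegree) :
    ∃ R : ℝ, ∀ᶠ n : ℕ in atTop, ∀ z ∈ filledJuliaSet (affineIterate a b f n), ‖z‖ ≤ R := by
  obtain ⟨R, hR, h⟩ := exists_eventually_mul_norm_le_norm_eval_affineIterate ha b hf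
  exact ⟨R, h.mono fun n hn z hz => (norm_lt_of_mem_filledJuliaSet hR hn hz).le⟩

/-- A point outside the filled Julia set of `f` has a neighbourhood which is disjoint from the
filled Julia set of `a * f^n + b` for all large `n`. -/
theorem eventually_notMem_filledJuliaSet_affineIterate {a : ℂ} (ha : a ≠ 0) (b : ℂ)
    {f : ℂ[X]} (hf : 2 ≤ f.natDegree) {x : ℂ} (hx : x ∉ filledJuliaSet f) :
    ∀ᶠ q : ℕ × ℂ in atTop ×ˢ 𝓝 x, q.2 ∉ filledJuliaSet (affineIterate a b f q.1) := by
  obtain ⟨R, hR, h⟩ := exists_eventually_mul_norm_le_norm_eval_affineIterate ha b hf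
  obtain ⟨m, hm⟩ := exists_pow_le_norm_iterate hf le_rfl hx
  have ha' := norm_pos_iff.2 ha
  have hlarge : ∀ᶠ n : ℕ in atTop, R + ‖b‖ ≤ ‖a‖ / 2 ^ m * 2 ^ n :=
    eventually_le_pow (by positivity)
  refine ((h.and (hlarge.and (eventually_ge_atTop m))).prod_mk hm).mono ?_
  rintro ⟨n, z⟩ ⟨⟨hn, hn2, hmn⟩, hz⟩ hmem
  -- The escape radius is tested at the image of `z`, not at `z`.
  have h1 := norm_lt_of_mem_filledJuliaSet hR hn (eval_mem_filledJuliaSet_iff.2 hmem)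
  simp only at hn2 hmn hz h1
  obtain ⟨k, rfl⟩ := Nat.exists_eq_add_of_le hmn
  rw [eval_affineIterate] at h1
  have h3 := norm_sub_le_norm_add (a * (fun w : ℂ => f.eval w)^[m + k] z) b
  have h4 : ‖a‖ * 2 ^ k ≤ ‖a‖ * ‖(fun w : ℂ => f.eval w)^[m + k] z‖ := by gcongr; exact hz k
  have h5 : ‖a‖ / 2 ^ m * 2 ^ (m + k) = ‖a‖ * 2 ^ k := by rw [pow_add]; field_simp
  rw [norm_mul] at h3
  linarith

/-- The leading coefficient stays `a` while the degree `d ^ n` grows, so `|a| * (3/8) ^ (d ^ n)`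
tends to 0. -/
theorem eventually_not_filledJuliaSet_affineIterate_subset_closedBall {a : ℂ} (ha : a ≠ 0) (b : ℂ)
    {f : ℂ[X]} (hmonic : f.Monic) (hf : 2 ≤ f.natDegree) :
    ∀ᶠ n : ℕ in atTop, ∀ c : ℂ,
      ¬ filledJuliaSet (affineIterate a b f n) ⊆ Metric.closedBall c (1 / 8) := by
  filter_upwards [eventually_le_pow (t := ‖a‖) (s := 1 / 8) (by norm_num), eventually_ge_atTop 1]
    with n hn hn1
  refine not_filledJuliaSet_subset_closedBall (two_le_natDegree_affineIterate ha b hf hn1) ?_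
  rw [leadingCoeff_affineIterate ha b hmonic (by omega), natDegree_affineIterate ha]
  have hle : n ≤ f.natDegree ^ n := (Nat.lt_pow_self (by omega)).le
  calc ‖a‖ * (3 / 8) ^ f.natDegree ^ n ≤ 1 / 8 * 2 ^ n * (1 / 2) ^ n := by
        gcongr
        exact (pow_le_pow_of_le_one (by norm_num) (by norm_num) hle).trans
          (pow_le_pow_left₀ (by norm_num) (by norm_num) n)
    _ = 1 / 8 := by rw [mul_assoc, ← mul_pow]; norm_num

/-- Otherwise the interior and the exterior of `s` would separate `t`. -/
theorem IsPreconnected.inter_frontier_nonempty_of_mem {s t : Set ℂ} (ht : IsPreconnected t)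
    (h1 : (t ∩ s).Nonempty) (h2 : (t \ s).Nonempty) : (t ∩ frontier s).Nonempty := by
  by_contra hne
  rw [Set.not_nonempty_iff_eq_empty] at hne
  have hfr : ∀ z ∈ t, z ∉ frontier s := fun z hz hzf =>
    Set.notMem_empty z (hne ▸ ⟨hz, hzf⟩)
  have hcover : t ⊆ interior s ∪ (closure s)ᶜ := by
    intro z hz
    by_cases hzc : z ∈ closure s
    · left
      by_contra hzi
      exact hfr z hz ⟨hzc, hzi⟩
    · exact Or.inr hzc
  have hdisj : Disjoint (interior s) (closure s)ᶜ :=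
    Set.disjoint_compl_right_iff_subset.2 interior_subset_closure
  obtain ⟨x, hxt, hxs⟩ := h1
  obtain ⟨y, hyt, hys⟩ := h2
  rcases ht.subset_or_subset isOpen_interior isClosed_closure.isOpen_compl hdisj hcover with h | h
  · exact hys (interior_subset (h hyt))
  · exact h hxt (subset_closure hxs)

/-- Every neighbourhood of a point of the Julia set of `f` meets the Julia set of `a * f^n + b`
for all large `n`. -/
theorem eventually_ball_inter_juliaSet_nonempty {a : ℂ} (ha : a ≠ 0) (b : ℂ)
    {f : ℂ[X]} (hmonic : f.Monic) (hf : 2 ≤ f.natDegree) {x : ℂ} (hx : x ∈ juliaSet f)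
    {ε : ℝ} (hε : 0 < ε) :
    ∀ᶠ n : ℕ in atTop, (Metric.ball x ε ∩ juliaSet (affineIterate a b f n)).Nonempty := by
  set d := f.natDegree with hd
  have hd2 : (2 : ℝ) ≤ d := by exact_mod_cast hf
  have hxK : x ∈ filledJuliaSet f := juliaSet_subset_filledJuliaSet hf hx
  -- The Schottky estimate is centred at `y` with radius `ε / 2`; `ε / 20` is a tenth of that.
  obtain ⟨y, hyK, hyx⟩ : ∃ y ∉ filledJuliaSet f, dist x y < ε / 20 := by
    have hxc : x ∈ closure (filledJuliaSet f)ᶜ := by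
      rw [closure_compl]
      exact hx.2
    obtain ⟨y, hy, hxy⟩ := Metric.mem_closure_iff.1 hxc (ε / 20) (by positivity)
    exact ⟨y, hy, hxy⟩
  have hsub : Metric.ball y (ε / 2) ⊆ Metric.ball x ε :=
    Metric.ball_subset_ball' (by rw [dist_comm]; linarith)
  have hyx' : y ∈ Metric.ball x ε := by
    rw [Metric.mem_ball, dist_comm]
    linarith
  obtain ⟨C, hC⟩ := isBounded_iff_forall_norm_le.1 (mem_filledJuliaSet_iff.1 hxK)
  obtain ⟨R, hR⟩ := exists_eventually_filledJuliaSet_subset_ball ha b hf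
  obtain ⟨M, hM0, hM⟩ := exists_norm_iterate_le_exp hf (‖x‖ + ε)
  -- The ratio `2 * d` beats the factor `d ^ n` from `exists_norm_iterate_le_exp` by `2 ^ n`.
  obtain ⟨m, hm⟩ := exists_pow_le_norm_iterate hf (K := 2 * d) (by linarith) hyK
  have hm := hm.self_of_nhds
  have hyn : ∀ᶠ n : ℕ in atTop, y ∉ filledJuliaSet (affineIterate a b f n) :=
    (eventually_notMem_filledJuliaSet_affineIterate ha b hf hyK).curry.mono
      fun n hn => hn.self_of_nhds
  have ha' : 0 < ‖a‖ := norm_pos_iff.2 ha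
  set U : ℝ := (|R| + ‖b‖) / ‖a‖ with hU
  have hU0 : 0 ≤ U := by positivity
  set δ : ℝ := 1 / 8 / ‖a‖ with hδ
  have hδ0 : 0 < δ := by positivity
  set B : ℝ := 4 * (M + U + 1) + 1 with hB
  -- `U` absorbs the omitted value, `4 * U * B` gives hypothesis `hq` of the Schottky estimate, the
  -- last term matches its conclusion at `x`, and `1` leaves a strict excess.
  set T : ℝ := 1 + U + 4 * U * B + 6 * B * (C + U) ^ 2 / δ with hT
  have hB0 : 0 < B := by positivity
  filter_upwards [hR, hyn, eventually_not_filledJuliaSet_affineIterate_subset_closedBall ha b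
    hmonic hf, eventually_ge_atTop 1, eventually_ge_atTop m,
    eventually_le_pow (t := T) (s := 1 / (2 * d) ^ m) (by positivity)]
    with n hRn hynn hnsub hn1 hmn hTn
  by_contra hempty
  set P := affineIterate a b f n with hP
  have hP2 : 2 ≤ P.natDegree := two_le_natDegree_affineIterate ha b hf hn1
  have hmiss : ∀ z ∈ Metric.ball x ε, z ∉ filledJuliaSet P := by
    intro z hz hzK
    exact hempty (IsPreconnected.inter_frontier_nonempty_of_mem
      (convex_ball x ε).isPreconnected ⟨z, hz, hzK⟩ ⟨y, hyx', hynn⟩)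
  obtain ⟨w, hw⟩ := filledJuliaSet_nonempty hP2
  obtain ⟨w', hw', hww⟩ : ∃ w' ∈ filledJuliaSet P, 1 / 8 < ‖w - w'‖ := by
    obtain ⟨w', hw', h⟩ := Set.not_subset.1 (hnsub w)
    rw [mem_closedBall_iff_norm, not_le, norm_sub_rev] at h
    exact ⟨w', hw', h⟩
  set F : ℂ → ℂ := (fun w : ℂ => f.eval w)^[n] with hF
  have hFd : Differentiable ℂ F := by
    have : F = fun z => (f.comp^[n] X).eval z := by
      ext z
      simp [hF]
    rw [this]
    exact Polynomial.differentiable _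
  have homit : ∀ v ∈ filledJuliaSet P, ∀ z ∈ Metric.ball y (ε / 2), F z ≠ (v - b) / a := by
    intro v hv z hz h
    refine hmiss z (hsub hz) (eval_mem_filledJuliaSet_iff.1 ?_)
    have : P.eval z = v := by
      rw [hP, eval_affineIterate]
      change a * F z + b = v
      rw [h]
      field_simp
      ring
    rwa [this]
  have hbound : ∀ v ∈ filledJuliaSet P, ‖(v - b) / a‖ ≤ U := by
    intro v hv
    rw [norm_div, hU]
    gcongr
    exact (norm_sub_le _ _).trans (by gcongr; exact (hRn v hv).trans (le_abs_self R))
  set u := (w - b) / a with hu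
  set v := (w' - b) / a with hv
  have huU : ‖u‖ ≤ U := hbound w hw
  have hvU : ‖v‖ ≤ U := hbound w' hw'
  have huv : δ ≤ ‖u - v‖ := by
    have : u - v = (w - w') / a := by
      rw [hu, hv]
      ring
    rw [this, norm_div, hδ]
    gcongr
  set E : ℝ := (d : ℝ) ^ n with hE
  have hE1 : 1 ≤ E := one_le_pow₀ (by linarith)
  have hexp : ∀ t : ℂ, ‖t‖ ≤ U → ∀ z ∈ Metric.ball y (ε / 2),
      ‖F z - t‖ ≤ Real.exp ((M + U + 1) * E) := by
    intro t ht z hz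
    have hzx : ‖z‖ ≤ ‖x‖ + ε := by
      have := hsub hz
      rw [mem_ball_iff_norm] at this
      linarith [norm_sub_norm_le z x]
    have h1 : ‖F z‖ ≤ Real.exp (M * E) := hM n z hzx
    have h2 : 1 ≤ Real.exp (M * E) := Real.one_le_exp (by positivity)
    calc ‖F z - t‖ ≤ Real.exp (M * E) + U := (norm_sub_le _ _).trans (add_le_add h1 ht)
      _ ≤ Real.exp (M * E) * (U + 1) := by nlinarith
      _ ≤ Real.exp (M * E) * Real.exp U := by gcongr; exact Real.add_one_le_exp U
      _ = Real.exp (M * E + U) := (Real.exp_add _ _).symm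
      _ ≤ Real.exp ((M + U + 1) * E) := by
        rw [Real.exp_le_exp]
        nlinarith
  have hFy : T * E ≤ ‖F y‖ := by
    obtain ⟨k, rfl⟩ := Nat.exists_eq_add_of_le hmn
    calc T * E ≤ 1 / (2 * d) ^ m * 2 ^ (m + k) * E := by gcongr
      _ = (2 * d) ^ k := by
        rw [hE, mul_assoc, ← mul_pow, pow_add]
        field_simp
      _ ≤ ‖F y‖ := hm k
  have hcent : ∀ t : ℂ, ‖t‖ ≤ U →
      (1 + 4 * U * B + 6 * B * (C + U) ^ 2 / δ) * E ≤ ‖F y - t‖ := by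
    intro t ht
    have := norm_sub_norm_le (F y) t
    nlinarith
  have hFx : ‖F x - v‖ ≤ C + U := (norm_sub_le _ _).trans (add_le_add (hC _ ⟨n, rfl⟩) hvU)
  have hFu := homit w hw
  have hFv := homit w' hw'
  rw [← hu] at hFu
  rw [← hv] at hFv
  clear_value F U δ B E T u v
  have hS0 : 0 ≤ 6 * B * (C + U) ^ 2 / δ := by positivity
  have hUB : 0 ≤ 4 * U * B := by positivity
  have hone : ∀ t : ℂ, ‖t‖ ≤ U → 1 ≤ ‖F y - t‖ := fun t ht => by nlinarith [hcent t ht]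
  have hBE : 4 * ((M + U + 1) * E) + 1 ≤ B * E := by nlinarith
  have huv2 : ‖u - v‖ ≤ 2 * U := (norm_sub_le _ _).trans (by linarith)
  have key := norm_mul_le_of_omits (F := F) (c := y) (u := u) (v := v) (r := ε / 2)
    (A := (M + U + 1) * E) (by positivity) (by positivity) hFd.differentiableOn
    hFu hFv (hexp u huU) (hexp v hvU) (hone u huU) (hone v hvU)
    (fun h => by rw [h, sub_self, norm_zero] at huv; linarith)
    (by
      refine le_trans ?_ (hcent v hvU)
      calc 2 * (4 * ((M + U + 1) * E) + 1) * ‖u - v‖ ≤ 2 * (B * E) * (2 * U) := by gcongr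
        _ = 4 * U * B * E := by ring
        _ ≤ _ := by gcongr; linarith)
    (z := x) (by rw [← dist_eq_norm]; linarith)
  have hcontra : δ * ((1 + 4 * U * B + 6 * B * (C + U) ^ 2 / δ) * E) ≤
      6 * (B * E) * (C + U) ^ 2 := by
    calc _ ≤ ‖u - v‖ * ‖F y - v‖ := by gcongr; exact hcent v hvU
      _ ≤ _ := key
      _ ≤ _ := by gcongr
  have hexpand : δ * ((1 + 4 * U * B + 6 * B * (C + U) ^ 2 / δ) * E) =
      δ * (1 + 4 * U * B) * E + 6 * (B * E) * (C + U) ^ 2 := by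
    field_simp
  have : 0 < δ * (1 + 4 * U * B) * E := by positivity
  linarith

end AffineIterate

/-! ### Set limits and Hausdorff convergence -/

section Limits

theorem mem_setLiminf {S : ℕ → Set ℂ} {x : ℂ} : x ∈ setLiminf S ↔
    ∃ z : ℕ → ℂ, (∀ n, 1 ≤ n → z n ∈ S n) ∧ Tendsto z atTop (𝓝 x) :=
  Iff.rfl

theorem mem_setLimsup {S : ℕ → Set ℂ} {x : ℂ} : x ∈ setLimsup S ↔
    ∃ n : ℕ → ℕ, StrictMono n ∧ (∀ k, 1 ≤ n k) ∧
      ∃ z : ℕ → ℂ, (∀ k, z k ∈ S (n k)) ∧ Tendsto z atTop (𝓝 x) :=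
  Iff.rfl

theorem setLiminf_subset_setLimsup (S : ℕ → Set ℂ) : setLiminf S ⊆ setLimsup S := by
  intro x hx
  obtain ⟨z, hz, hlim⟩ := mem_setLiminf.1 hx
  exact mem_setLimsup.2 ⟨fun k => k + 1, fun i j h => Nat.succ_lt_succ h, fun k => Nat.le_add_left 1 k,
    fun k => z (k + 1), fun k => hz _ (Nat.le_add_left 1 k), hlim.comp (tendsto_add_atTop_nat 1)⟩

theorem setLimsup_mono {S T : ℕ → Set ℂ} (h : ∀ n, 1 ≤ n → S n ⊆ T n) :
    setLimsup S ⊆ setLimsup T := by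
  intro x hx
  obtain ⟨n, hn, hn1, z, hz, hlim⟩ := mem_setLimsup.1 hx
  exact mem_setLimsup.2 ⟨n, hn, hn1, z, fun k => h _ (hn1 k) (hz k), hlim⟩

theorem notMem_setLimsup_of_eventually {S : ℕ → Set ℂ} {x : ℂ}
    (h : ∀ᶠ q : ℕ × ℂ in atTop ×ˢ 𝓝 x, q.2 ∉ S q.1) : x ∉ setLimsup S := by
  intro hx
  obtain ⟨n, hn, -, z, hz, hlim⟩ := mem_setLimsup.1 hx
  obtain ⟨k, hk⟩ := ((hn.tendsto_atTop.prodMk hlim).eventually h).exists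
  exact hk (hz k)

theorem mem_setLiminf_of_eventually {S : ℕ → Set ℂ} {x : ℂ}
    (hne : ∀ n, 1 ≤ n → (S n).Nonempty) (hc : ∀ n, 1 ≤ n → IsCompact (S n))
    (h : ∀ ε : ℝ, 0 < ε → ∀ᶠ n in atTop, (Metric.ball x ε ∩ S n).Nonempty) :
    x ∈ setLiminf S := by
  have hex : ∀ n, ∃ y, 1 ≤ n → y ∈ S n ∧ Metric.infDist x (S n) = dist x y := by
    intro n
    by_cases hn : 1 ≤ n
    · obtain ⟨y, hy, hxy⟩ := (hc n hn).exists_infDist_eq_dist (hne n hn) x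
      exact ⟨y, fun _ => ⟨hy, hxy⟩⟩
    -- Index 0 is unconstrained; elsewhere `z n` is a nearest point to `x`.
    · exact ⟨x, fun h => absurd h hn⟩
  choose z hz using hex
  refine mem_setLiminf.2 ⟨z, fun n hn => (hz n hn).1, Metric.tendsto_nhds.2 fun ε hε => ?_⟩
  filter_upwards [h ε hε, eventually_ge_atTop 1] with n ⟨y, hyx, hy⟩ hn
  rw [dist_comm, ← (hz n hn).2]
  exact (Metric.infDist_le_dist_of_mem hy).trans_lt (by rwa [dist_comm])

theorem IsCompact.eventually_forall_of_prod {K : Set ℂ} (hK : IsCompact K) {Q : ℕ → ℂ → Prop}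
    (hQ : ∀ y ∈ K, ∀ᶠ q : ℕ × ℂ in atTop ×ˢ 𝓝 y, Q q.1 q.2) :
    ∀ᶠ n in atTop, ∀ y ∈ K, Q n y := by
  have h : ∀ᶠ q : ℕ × ℂ in atTop ×ˢ 𝓝ˢ K, Q q.1 q.2 := hK.mem_prod_nhdsSet_of_forall hQ
  exact h.curry.mono fun _ h => h.self_of_nhdsSet

/-- The part of the disk of radius `R` outside the `δ`-thickening of `L` is compact, so local
avoidance becomes uniform in `n`. -/
theorem eventually_forall_exists_dist_lt_of_escape {S : ℕ → Set ℂ} {L : Set ℂ} {R : ℝ}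
    (hR : ∀ᶠ n in atTop, ∀ z ∈ S n, ‖z‖ ≤ R)
    (hL : ∀ x ∉ L, ∀ᶠ q : ℕ × ℂ in atTop ×ˢ 𝓝 x, q.2 ∉ S q.1) {δ : ℝ} (hδ : 0 < δ) :
    ∀ᶠ n in atTop, ∀ z ∈ S n, ∃ y ∈ L, dist z y < δ := by
  have hcpt : IsCompact (Metric.closedBall (0 : ℂ) R \ Metric.thickening δ L) :=
    (isCompact_closedBall _ _).diff Metric.isOpen_thickening
  have h := hcpt.eventually_forall_of_prod (Q := fun n z => z ∉ S n)
    fun x hx => hL x fun hxL => hx.2 (Metric.self_subset_thickening hδ L hxL)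
  filter_upwards [h, hR] with n hn hRn z hz
  by_contra hfar
  exact hn z ⟨mem_closedBall_zero_iff.2 (hRn z hz),
    fun ht => hfar (Metric.mem_thickening_iff.1 ht)⟩ hz

theorem eventually_forall_exists_dist_lt_of_meets {S : ℕ → Set ℂ} {L : Set ℂ} (hcpt : IsCompact L)
    (hL : ∀ x ∈ L, ∀ ε : ℝ, 0 < ε → ∀ᶠ n in atTop, (Metric.ball x ε ∩ S n).Nonempty)
    {δ : ℝ} (hδ : 0 < δ) : ∀ᶠ n in atTop, ∀ x ∈ L, ∃ y ∈ S n, dist x y < δ := by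
  refine hcpt.eventually_forall_of_prod fun x hx => ?_
  refine ((hL x hx (δ / 2) (half_pos hδ)).prod_mk
    (Metric.ball_mem_nhds x (half_pos hδ))).mono ?_
  rintro ⟨n, z⟩ ⟨⟨y, hyx, hy⟩, hz⟩
  exact ⟨y, hy, (dist_triangle_right z y x).trans_lt (by
    have h1 := Metric.mem_ball.1 hyx
    have h2 : dist z x < δ / 2 := hz
    linarith)⟩

theorem tendsto_hausdorffEDist_zero {S : ℕ → Set ℂ} {L : Set ℂ}
    (h1 : ∀ δ : ℝ, 0 < δ → ∀ᶠ n in atTop, ∀ z ∈ S n, ∃ y ∈ L, dist z y < δ)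
    (h2 : ∀ δ : ℝ, 0 < δ → ∀ᶠ n in atTop, ∀ x ∈ L, ∃ y ∈ S n, dist x y < δ) :
    Tendsto (fun n => Metric.hausdorffEDist (S n) L) atTop (𝓝 0) := by
  refine ENNReal.tendsto_nhds_zero.2 fun ε hε => ?_
  obtain ⟨δ, hδ, hδε⟩ : ∃ δ : ℝ, 0 < δ ∧ ENNReal.ofReal δ ≤ ε := by
    obtain ⟨δ, hδ, hδε⟩ := ENNReal.lt_iff_exists_nnreal_btwn.1 hε
    exact ⟨δ, by exact_mod_cast hδ, by simpa using hδε.le⟩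
  filter_upwards [h1 δ hδ, h2 δ hδ] with n hn1 hn2
  refine (Metric.hausdorffEDist_le_of_mem_edist (r := ENNReal.ofReal δ) ?_ ?_).trans hδε
  · intro z hz
    obtain ⟨y, hy, hzy⟩ := hn1 z hz
    exact ⟨y, hy, by rw [edist_dist]; exact ENNReal.ofReal_le_ofReal hzy.le⟩
  · intro z hz
    obtain ⟨y, hy, hzy⟩ := hn2 z hz
    exact ⟨y, hy, by rw [edist_dist]; exact ENNReal.ofReal_le_ofReal hzy.le⟩

end Limits

/-! ### The main theorem -/

theorem mainTheorem5 (f : Polynomial ℂ) (hmonic : f.Monic) (hdeg : 2 ≤ f.natDegree)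
    (hcentered : f.coeff (f.natDegree - 1) = 0) (a b : ℂ) (ha : a ≠ 0) :
    (juliaSet f ⊆ setLiminf (fun n => juliaSet (affineIterate a b f n)) ∧
      setLiminf (fun n => juliaSet (affineIterate a b f n)) ⊆
        setLimsup (fun n => filledJuliaSet (affineIterate a b f n)) ∧
      setLimsup (fun n => filledJuliaSet (affineIterate a b f n)) ⊆ filledJuliaSet f) ∧
    (juliaSet f = filledJuliaSet f →
      setLiminf (fun n => juliaSet (affineIterate a b f n)) = juliaSet f ∧
      setLimsup (fun n => juliaSet (affineIterate a b f n)) = juliaSet f ∧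
      TendstoHausdorff (fun n => juliaSet (affineIterate a b f n)) (juliaSet f)) := by
  have hd : ∀ n, 1 ≤ n → 2 ≤ (affineIterate a b f n).natDegree :=
    fun n hn => two_le_natDegree_affineIterate ha b hdeg hn
  have hJK : ∀ n, 1 ≤ n →
      juliaSet (affineIterate a b f n) ⊆ filledJuliaSet (affineIterate a b f n) :=
    fun n hn => juliaSet_subset_filledJuliaSet (hd n hn)
  have hmeets := fun x (hx : x ∈ juliaSet f) (ε : ℝ) (hε : 0 < ε) =>
    eventually_ball_inter_juliaSet_nonempty ha b hmonic hdeg hx hε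
  have hescape := fun x (hx : x ∉ filledJuliaSet f) =>
    eventually_notMem_filledJuliaSet_affineIterate ha b hdeg hx
  have hlower : juliaSet f ⊆ setLiminf (fun n => juliaSet (affineIterate a b f n)) :=
    fun x hx => mem_setLiminf_of_eventually (fun n hn => juliaSet_nonempty (hd n hn))
      (fun n hn => isCompact_juliaSet (hd n hn)) (hmeets x hx)
  have hupper : setLimsup (fun n => filledJuliaSet (affineIterate a b f n)) ⊆ filledJuliaSet f := by
    intro x hx
    by_contra hxK
    exact notMem_setLimsup_of_eventually (hescape x hxK) hx
  have hinf := setLiminf_subset_setLimsup fun n => juliaSet (affineIterate a b f n)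
  have hsup : setLimsup (fun n => juliaSet (affineIterate a b f n)) ⊆
      setLimsup (fun n => filledJuliaSet (affineIterate a b f n)) := setLimsup_mono hJK
  refine ⟨⟨hlower, hinf.trans hsup, hupper⟩, fun heq => ?_⟩
  have hupper' : setLimsup (fun n => juliaSet (affineIterate a b f n)) ⊆ juliaSet f :=
    heq ▸ hsup.trans hupper
  refine ⟨(hinf.trans hupper').antisymm hlower, hupper'.antisymm (hlower.trans hinf),
    fun n hn => ⟨juliaSet_nonempty (hd n hn), isCompact_juliaSet (hd n hn)⟩,
    juliaSet_nonempty hdeg, isCompact_juliaSet hdeg, ?_⟩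
  obtain ⟨R, hR⟩ := exists_eventually_filledJuliaSet_subset_ball ha b hdeg
  refine tendsto_hausdorffEDist_zero (fun δ hδ => ?_) fun δ hδ =>
    eventually_forall_exists_dist_lt_of_meets (isCompact_juliaSet hdeg) hmeets hδ
  -- Escape is known only off the filled Julia set, hence the need for `J_f = K_f`.
  rw [heq]
  filter_upwards [eventually_forall_exists_dist_lt_of_escape hR hescape hδ,
    eventually_ge_atTop 1] with n hn hn1 z hz
  exact hn z (hJK n hn1 hz)
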